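/- Let $M$ be a smooth (Hausdorff, second countable) manifold of dimension $2n+1$ with a para-Sasakian structure $(\phi,\xi,\eta,g)$. This means the following. The $1$-form $\eta$ is a contact form, i.e. $\eta\wedge(d\eta)^n\neq 0$ everywhere; $\xi$ is its Reeb vector field, i.e. $\eta(\xi)=1$ and $d\eta(\xi,\cdot)=0$; $\phi$ is a smooth $(1,1)$-tensor field and $g$ a semi-Riemannian metric such that $$\phi^2=\mathrm{Id}-\eta\otimes\xi,\qquad g(\phi X,\phi Y)=-g(X,Y)+\eta(X)\eta(Y),\qquad d\eta(X,Y)=g(X,\phi Y);$$ at every point $\phi$ preserves $\ker\eta$, and its restriction to $\ker\eta$ squares to the identity and has $\pm1$-eigenspaces of equal dimension; and $$\phi^2[X,Y]+[\phi X,\phi Y]-\phi[\phi X,Y]-\phi[X,\phi Y]-2\,d\eta(X,Y)\,\xi=0$$ for all vector fields $X,Y$. Here $2\,d\eta(X,Y)=X(\eta(Y))-Y(\eta(X))-\eta([X,Y])$. Let $\nabla$ be the Levi-Civita connection of $g$ and $R(X,Y)Z=\nabla_X\nabla_YZ-\nabla_Y\nabla_XZ-\nabla_{[X,Y]}Z$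 its curvature tensor. If $(M,g)$ is locally symmetric, i.e. $\nabla R=0$, then $(M,g)$ has constant sectional curvature $-1$: for every $p\in M$ and all $u,v\in T_pM$ with $g(u,u)g(v,v)-g(u,v)^2\neq 0$, $$\frac{g(R(u,v)v,u)}{g(u,u)g(v,v)-g(u,v)^2}=-1.$$ -/

import Mathlib

open Bundle VectorField
open scoped Manifold ContDiff

noncomputable section

namespace ParaSasaki

variable {E : Type*} [NormedAddCommGroup E] [NormedSpace ℝ E]
  {M : Type*} [TopologicalSpace M] [ChartedSpace E M]

/-- `X` is a (globally defined) smooth vector field. -/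
def SmoothField [IsManifold 𝓘(ℝ, E) ∞ M] (X : Π x : M, TangentSpace 𝓘(ℝ, E) x) : Prop :=
  ContMDiff 𝓘(ℝ, E) (𝓘(ℝ, E).prod 𝓘(ℝ, E)) ∞
    (fun x ↦ (TotalSpace.mk' E x (X x) : TangentBundle 𝓘(ℝ, E) M))

/-- `η` is a smooth `1`-form. -/
def SmoothOneForm [IsManifold 𝓘(ℝ, E) ∞ M] (η : Π x : M, TangentSpace 𝓘(ℝ, E) x →L[ℝ] ℝ) : Prop :=
  ContMDiff 𝓘(ℝ, E) (𝓘(ℝ, E).prod 𝓘(ℝ, E →L[ℝ] ℝ)) ∞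
    (fun x ↦ TotalSpace.mk' (E →L[ℝ] ℝ) (E := fun x : M ↦ TangentSpace 𝓘(ℝ, E) x →L[ℝ] ℝ) x (η x))

/-- `φ` is a smooth `(1,1)`-tensor field. -/
def SmoothEndo [IsManifold 𝓘(ℝ, E) ∞ M]
    (φ : Π x : M, TangentSpace 𝓘(ℝ, E) x →L[ℝ] TangentSpace 𝓘(ℝ, E) x) : Prop :=
  ContMDiff 𝓘(ℝ, E) (𝓘(ℝ, E).prod 𝓘(ℝ, E →L[ℝ] E)) ∞
    (fun x ↦ TotalSpace.mk' (E →L[ℝ] E) (E := fun x : M ↦ TangentSpace 𝓘(ℝ, E) x →L[ℝ] TangentSpace 𝓘(ℝ, E) x) x (φ x))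

/-- The derivative `X f` of a function along a vector field. -/
def lieD (X : Π x : M, TangentSpace 𝓘(ℝ, E) x) (f : M → ℝ) (x : M) : ℝ :=
  mvfderiv 𝓘(ℝ, E) f x (X x)

/-- The Lie bracket `[X, Y]` of vector fields. -/
abbrev bracket (X Y : Π x : M, TangentSpace 𝓘(ℝ, E) x) : Π x : M, TangentSpace 𝓘(ℝ, E) x :=
  mlieBracket 𝓘(ℝ, E) X Y

/-- A smooth semi-Riemannian metric on `M`: a smooth field of nondegenerate symmetric bilinear
forms on the tangent spaces (of arbitrary signature). -/
structure SemiRiemannianMetric (E M : Type*) [NormedAddCommGroup E] [NormedSpace ℝ E]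
    [TopologicalSpace M] [ChartedSpace E M] [IsManifold 𝓘(ℝ, E) ∞ M] where
  /-- the bilinear form on each tangent space -/
  val : Π x : M, TangentSpace 𝓘(ℝ, E) x →L[ℝ] TangentSpace 𝓘(ℝ, E) x →L[ℝ] ℝ
  symm : ∀ (x : M) (u v : TangentSpace 𝓘(ℝ, E) x), val x u v = val x v u
  nondegenerate : ∀ (x : M) (u : TangentSpace 𝓘(ℝ, E) x), (∀ v : TangentSpace 𝓘(ℝ, E) x, val x u v = 0) → u = 0
  contMDiff : ContMDiff 𝓘(ℝ, E) (𝓘(ℝ, E).prod 𝓘(ℝ, E →L[ℝ] E →L[ℝ] ℝ)) ∞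
    (fun x ↦ TotalSpace.mk' (E →L[ℝ] E →L[ℝ] ℝ)
      (E := fun x : M ↦ TangentSpace 𝓘(ℝ, E) x →L[ℝ] TangentSpace 𝓘(ℝ, E) x →L[ℝ] ℝ) x (val x))

section LeviCivita

variable [IsManifold 𝓘(ℝ, E) ∞ M] (g : SemiRiemannianMetric E M)

/-- The right-hand side of Koszul's formula, which is to be `2 g(∇_X Y, Z)`. -/
def koszul (X Y Z : Π x : M, TangentSpace 𝓘(ℝ, E) x) (x : M) : ℝ :=
  lieD X (fun y ↦ g.val y (Y y) (Z y)) x + lieD Y (fun y ↦ g.val y (X y) (Z y)) x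
    - lieD Z (fun y ↦ g.val y (X y) (Y y)) x
    + g.val x (bracket X Y x) (Z x) - g.val x (bracket X Z x) (Y x)
    - g.val x (bracket Y Z x) (X x)

variable {g}

theorem mdiffAt_metric {X Y : Π x : M, TangentSpace 𝓘(ℝ, E) x} {x : M}
    (hX : MDiffAt (T% X) x) (hY : MDiffAt (T% Y) x) :
    MDiffAt (fun y ↦ g.val y (X y) (Y y)) x := by
  have hg := (g.contMDiff.mdifferentiable (by simp)) x
  have : MDifferentiableAt 𝓘(ℝ, E) (𝓘(ℝ, E).prod 𝓘(ℝ))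
      (fun m ↦ TotalSpace.mk' ℝ (E := Bundle.Trivial M ℝ) m (g.val m (X m) (Y m))) x := by
    apply MDifferentiableAt.clm_bundle_apply₂ (F₁ := E) (F₂ := E)
    · exact hg
    · exact hX
    · exact hY
  simp only [mdifferentiableAt_totalSpace] at this
  exact this.2

theorem ext_of_metric (g : SemiRiemannianMetric E M) {x : M} {u v : TangentSpace 𝓘(ℝ, E) x}
    (h : ∀ Z : Π x : M, TangentSpace 𝓘(ℝ, E) x, MDiffAt (T% Z) x → g.val x u (Z x) = g.val x v (Z x)) :
    u = v := by
  rw [← sub_eq_zero]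
  refine g.nondegenerate x _ fun w ↦ ?_
  have := h (FiberBundle.extend E w) (FiberBundle.mdifferentiableAt_extend ..)
  simp only [FiberBundle.extend_apply_self] at this
  simp [this]

variable [FiniteDimensional ℝ E]

theorem koszul_tensorial_left {Y Z : Π x : M, TangentSpace 𝓘(ℝ, E) x} {x : M}
    (hY : MDiffAt (T% Y) x) (hZ : MDiffAt (T% Z) x) :
    TensorialAt 𝓘(ℝ, E) E (fun X ↦ koszul g X Y Z x) x where
  smul {f X} hf hX := by
    have h1 : (fun y ↦ g.val y ((f • X) y) (Z y)) = f * fun y ↦ g.val y (X y) (Z y) := by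
      ext y; simp
    have h2 : (fun y ↦ g.val y ((f • X) y) (Y y)) = f * fun y ↦ g.val y (X y) (Y y) := by
      ext y; simp
    simp only [koszul, lieD, bracket, h1, h2, mvfderiv_mul hf (mdiffAt_metric hX hZ),
      mvfderiv_mul hf (mdiffAt_metric hX hY), mlieBracket_smul_left hf hX]
    simp
    ring
  add {X X'} hX hX' := by
    have h1 : (fun y ↦ g.val y ((X + X') y) (Z y)) =
        (fun y ↦ g.val y (X y) (Z y)) + fun y ↦ g.val y (X' y) (Z y) := by
      ext y; simp
    have h2 : (fun y ↦ g.val y ((X + X') y) (Y y)) =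
        (fun y ↦ g.val y (X y) (Y y)) + fun y ↦ g.val y (X' y) (Y y) := by
      ext y; simp
    simp only [koszul, lieD, bracket, h1, h2,
      mvfderiv_add (mdiffAt_metric hX hZ) (mdiffAt_metric hX' hZ),
      mvfderiv_add (mdiffAt_metric hX hY) (mdiffAt_metric hX' hY), mlieBracket_add_left hX hX']
    simp
    ring

theorem koszul_tensorial_right {X Y : Π x : M, TangentSpace 𝓘(ℝ, E) x} {x : M}
    (hX : MDiffAt (T% X) x) (hY : MDiffAt (T% Y) x) :
    TensorialAt 𝓘(ℝ, E) E (fun Z ↦ koszul g X Y Z x) x where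
  smul {f Z} hf hZ := by
    have h1 : (fun y ↦ g.val y (Y y) ((f • Z) y)) = f * fun y ↦ g.val y (Y y) (Z y) := by
      ext y; simp
    have h2 : (fun y ↦ g.val y (X y) ((f • Z) y)) = f * fun y ↦ g.val y (X y) (Z y) := by
      ext y; simp
    simp only [koszul, lieD, bracket, h1, h2, mvfderiv_mul hf (mdiffAt_metric hX hZ),
      mvfderiv_mul hf (mdiffAt_metric hY hZ), mlieBracket_smul_right hf hZ]
    simp [g.symm x (Z x) (X x), g.symm x (Z x) (Y x)]
    ring
  add {Z Z'} hZ hZ' := by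
    have h1 : (fun y ↦ g.val y (Y y) ((Z + Z') y)) =
        (fun y ↦ g.val y (Y y) (Z y)) + fun y ↦ g.val y (Y y) (Z' y) := by
      ext y; simp
    have h2 : (fun y ↦ g.val y (X y) ((Z + Z') y)) =
        (fun y ↦ g.val y (X y) (Z y)) + fun y ↦ g.val y (X y) (Z' y) := by
      ext y; simp
    simp only [koszul, lieD, bracket, h1, h2,
      mvfderiv_add (mdiffAt_metric hX hZ) (mdiffAt_metric hX hZ'),
      mvfderiv_add (mdiffAt_metric hY hZ) (mdiffAt_metric hY hZ'), mlieBracket_add_right hZ hZ']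
    simp
    ring

theorem koszul_add_mid {X Y Y' Z : Π x : M, TangentSpace 𝓘(ℝ, E) x} {x : M} (hX : MDiffAt (T% X) x)
    (hY : MDiffAt (T% Y) x) (hY' : MDiffAt (T% Y') x) (hZ : MDiffAt (T% Z) x) :
    koszul g X (Y + Y') Z x = koszul g X Y Z x + koszul g X Y' Z x := by
  have h1 : (fun y ↦ g.val y ((Y + Y') y) (Z y)) =
      (fun y ↦ g.val y (Y y) (Z y)) + fun y ↦ g.val y (Y' y) (Z y) := by
    ext y; simp
  have h2 : (fun y ↦ g.val y (X y) ((Y + Y') y)) =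
      (fun y ↦ g.val y (X y) (Y y)) + fun y ↦ g.val y (X y) (Y' y) := by
    ext y; simp
  simp only [koszul, lieD, bracket, h1, h2,
    mvfderiv_add (mdiffAt_metric hY hZ) (mdiffAt_metric hY' hZ),
    mvfderiv_add (mdiffAt_metric hX hY) (mdiffAt_metric hX hY'), mlieBracket_add_left hY hY',
    mlieBracket_add_right hY hY']
  simp
  ring

theorem koszul_smul_mid {f : M → ℝ} {X Y Z : Π x : M, TangentSpace 𝓘(ℝ, E) x} {x : M} (hf : MDiffAt f x)
    (hX : MDiffAt (T% X) x) (hY : MDiffAt (T% Y) x) (hZ : MDiffAt (T% Z) x) :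
    koszul g X (f • Y) Z x =
      f x * koszul g X Y Z x + 2 * (lieD X f x * g.val x (Y x) (Z x)) := by
  have h1 : (fun y ↦ g.val y ((f • Y) y) (Z y)) = f * fun y ↦ g.val y (Y y) (Z y) := by
    ext y; simp
  have h2 : (fun y ↦ g.val y (X y) ((f • Y) y)) = f * fun y ↦ g.val y (X y) (Y y) := by
    ext y; simp
  simp only [koszul, lieD, bracket, h1, h2, mvfderiv_mul hf (mdiffAt_metric hX hY),
    mvfderiv_mul hf (mdiffAt_metric hY hZ), mlieBracket_smul_right hf hY,
    mlieBracket_smul_left hf hY]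
  simp [g.symm x (Y x) (X x)]
  ring

variable (g)

/-- The musical isomorphism `u ↦ g(u, ·)`. -/
def flat (x : M) : TangentSpace 𝓘(ℝ, E) x ≃ₗ[ℝ] (TangentSpace 𝓘(ℝ, E) x →L[ℝ] ℝ) :=
  haveI : FiniteDimensional ℝ (TangentSpace 𝓘(ℝ, E) x) := inferInstanceAs (FiniteDimensional ℝ E)
  haveI : T2Space (TangentSpace 𝓘(ℝ, E) x) := inferInstanceAs (T2Space E)
  LinearMap.linearEquivOfInjective (g.val x).toLinearMap
    (by
      rw [← LinearMap.ker_eq_bot, LinearMap.ker_eq_bot']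
      intro u hu
      exact g.nondegenerate x u fun v ↦ by simpa using congr($hu v))
    (by
      rw [← LinearEquiv.finrank_eq (LinearMap.toContinuousLinearMap (𝕜 := ℝ)
        (E := TangentSpace 𝓘(ℝ, E) x) (F' := ℝ))]
      exact Subspace.dual_finrank_eq.symm)

open scoped Classical in
/-- The endomorphism `u ↦ ∇_u Y` of `T_x M` determined by Koszul's formula
`2 g(∇_X Y, Z) = koszul X Y Z`, for `Y` differentiable at `x` (and zero otherwise). -/
def nabla (Y : Π x : M, TangentSpace 𝓘(ℝ, E) x) (x : M) : TangentSpace 𝓘(ℝ, E) x →L[ℝ] TangentSpace 𝓘(ℝ, E) x :=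
  haveI : FiniteDimensional ℝ (TangentSpace 𝓘(ℝ, E) x) := inferInstanceAs (FiniteDimensional ℝ E)
  haveI : T2Space (TangentSpace 𝓘(ℝ, E) x) := inferInstanceAs (T2Space E)
  if hY : MDiffAt (T% Y) x then
    LinearMap.toContinuousLinearMap ((flat g x).symm.toLinearMap ∘ₗ
      ((1 / 2 : ℝ) • (TensorialAt.mkHom₂ (fun X Z ↦ koszul g X Y Z x) x
        (fun _ hZ ↦ koszul_tensorial_left hY hZ)
        (fun _ hX ↦ koszul_tensorial_right hX hY)).toLinearMap))
  else 0

theorem nabla_koszul {X Y Z : Π x : M, TangentSpace 𝓘(ℝ, E) x} {x : M} (hX : MDiffAt (T% X) x)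
    (hY : MDiffAt (T% Y) x) (hZ : MDiffAt (T% Z) x) :
    2 * g.val x (nabla g Y x (X x)) (Z x) = koszul g X Y Z x := by
  have hflat : ∀ (α : TangentSpace 𝓘(ℝ, E) x →L[ℝ] ℝ) v, g.val x ((flat g x).symm α) v = α v := fun α v ↦
    congr($((flat g x).apply_symm_apply α) v)
  rw [← TensorialAt.mkHom₂_apply (fun _ hZ ↦ koszul_tensorial_left (g := g) hY hZ)
    (fun _ hX ↦ koszul_tensorial_right (g := g) hX hY) hX hZ]
  simp only [nabla, hY, dite_true]
  simp [hflat]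

/-- The Levi-Civita connection of a semi-Riemannian metric;
`leviCivita g Y x (X x)` is `(∇_X Y)(x)`. -/
def leviCivita : CovariantDerivative 𝓘(ℝ, E) E (TangentSpace 𝓘(ℝ, E) : M → Type _) where
  toFun := nabla g
  isCovariantDerivativeOnUniv :=
    { add := by
        intro Y Y' x hY hY' _
        ext u
        refine ext_of_metric g fun Z hZ ↦ ?_
        have hu := FiberBundle.mdifferentiableAt_extend 𝓘(ℝ, E) E u
        have h1 := nabla_koszul g hu (mdifferentiableAt_add_section hY hY') hZ
        have h2 := nabla_koszul g hu hY hZ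
        have h3 := nabla_koszul g hu hY' hZ
        rw [koszul_add_mid hu hY hY' hZ] at h1
        simp only [FiberBundle.extend_apply_self] at h1 h2 h3
        simp only [_root_.add_apply, map_add]
        linarith
      leibniz := by
        intro Y f x hY hf _
        ext u
        refine ext_of_metric g fun Z hZ ↦ ?_
        have hu := FiberBundle.mdifferentiableAt_extend 𝓘(ℝ, E) E u
        have h1 := nabla_koszul g hu (hf.smul_section hY) hZ
        have h2 := nabla_koszul g hu hY hZ
        rw [koszul_smul_mid hf hu hY hZ] at h1
        simp only [lieD, FiberBundle.extend_apply_self] at h1 h2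
        simp
        linear_combination (1 / 2) * h1 - (1 / 2) * f x * h2 }

/-- `∇_X Y` for the Levi-Civita connection. -/
def covD (X Y : Π x : M, TangentSpace 𝓘(ℝ, E) x) : Π x : M, TangentSpace 𝓘(ℝ, E) x :=
  fun x ↦ leviCivita g Y x (X x)

/-- The Riemann curvature `R(X, Y) Z = ∇_X ∇_Y Z - ∇_Y ∇_X Z - ∇_{[X, Y]} Z`. -/
def curv (X Y Z : Π x : M, TangentSpace 𝓘(ℝ, E) x) : Π x : M, TangentSpace 𝓘(ℝ, E) x :=
  fun x ↦ covD g X (covD g Y Z) x - covD g Y (covD g X Z) x - covD g (bracket X Y) Z x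

/-- The covariant derivative of the curvature tensor,
`(∇_V R)(X, Y) Z = ∇_V (R(X, Y) Z) - R(∇_V X, Y) Z - R(X, ∇_V Y) Z - R(X, Y) ∇_V Z`. -/
def covDCurv (V X Y Z : Π x : M, TangentSpace 𝓘(ℝ, E) x) : Π x : M, TangentSpace 𝓘(ℝ, E) x :=
  fun x ↦ covD g V (curv g X Y Z) x - curv g (covD g V X) Y Z x
    - curv g X (covD g V Y) Z x - curv g X Y (covD g V Z) x

/-- `g` is locally symmetric: `∇ R = 0`. -/
def IsLocallySymmetric : Prop :=
  ∀ V X Y Z : Π x : M, TangentSpace 𝓘(ℝ, E) x, SmoothField V → SmoothField X → SmoothField Y → SmoothField Z →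
    ∀ x, covDCurv g V X Y Z x = 0

/-- The determinant `g(u, u) g(v, v) - g(u, v)²`; vectors `u, v` span a nondegenerate plane of
`T_x M` if and only if it is nonzero. -/
def gram (x : M) (u v : TangentSpace 𝓘(ℝ, E) x) : ℝ :=
  g.val x u u * g.val x v v - g.val x u v ^ 2

/-- The sectional curvature `g(R(X, Y) Y, X) / (g(X, X) g(Y, Y) - g(X, Y)²)` at `x` of the plane
spanned by `X x, Y x`, when this plane is nondegenerate. -/
def sectionalCurvature (X Y : Π x : M, TangentSpace 𝓘(ℝ, E) x) (x : M) : ℝ :=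
  g.val x (curv g X Y Y x) (X x) / gram g x (X x) (Y x)

/-- `g` has constant sectional curvature `c`: the sectional curvature of every nondegenerate
tangent plane, at every point, is `c` (every pair of tangent vectors at a point is the value there
of a pair of smooth vector fields). -/
def HasConstantSectionalCurvature (c : ℝ) : Prop :=
  ∀ X Y : Π x : M, TangentSpace 𝓘(ℝ, E) x, SmoothField X → SmoothField Y →
    ∀ x, gram g x (X x) (Y x) ≠ 0 → sectionalCurvature g X Y x = c

end LeviCivita

section Contact

/-- The exterior derivative of a `1`-form, with the normalisation
`2 dη(X, Y) = X η(Y) - Y η(X) - η([X, Y])`. -/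
def extD (η : Π x : M, TangentSpace 𝓘(ℝ, E) x →L[ℝ] ℝ) (X Y : Π x : M, TangentSpace 𝓘(ℝ, E) x) (x : M) : ℝ :=
  (lieD X (fun y ↦ η y (Y y)) x - lieD Y (fun y ↦ η y (X y)) x - η x (bracket X Y x)) / 2

/-- The `(2n+1)`-form `η ∧ (dη)^n`, up to a nonzero constant factor that depends only on `n`,
evaluated at `x` on `V 0, …, V (2n)`: the antisymmetrisation of `η ⊗ dη ⊗ ⋯ ⊗ dη`. -/
def contactVolume (n : ℕ) (η : Π x : M, TangentSpace 𝓘(ℝ, E) x →L[ℝ] ℝ)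
    (V : Fin (2 * n + 1) → Π x : M, TangentSpace 𝓘(ℝ, E) x) (x : M) : ℝ :=
  ∑ σ : Equiv.Perm (Fin (2 * n + 1)), ((Equiv.Perm.sign σ : ℤ) : ℝ) *
    (η x (V (σ 0) x) * ∏ i : Fin n,
      extD η (V (σ ⟨2 * i + 1, by omega⟩)) (V (σ ⟨2 * i + 2, by omega⟩)) x)

/-- `η` is a contact form on the `(2n+1)`-dimensional manifold `M`: a smooth `1`-form such that
`η ∧ (dη)^n` vanishes nowhere. -/
structure IsContactForm [IsManifold 𝓘(ℝ, E) ∞ M] (n : ℕ) (η : Π x : M, TangentSpace 𝓘(ℝ, E) x →L[ℝ] ℝ) :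
    Prop where
  smooth : SmoothOneForm η
  finrank_eq : Module.finrank ℝ E = 2 * n + 1
  volume_ne_zero : ∀ x, ∃ V : Fin (2 * n + 1) → Π x : M, TangentSpace 𝓘(ℝ, E) x,
    (∀ i, SmoothField (V i)) ∧ contactVolume n η V x ≠ 0

/-- `ξ` is the Reeb vector field of `η`: `η(ξ) = 1` and `dη(ξ, ·) = 0`. -/
structure IsReebField [IsManifold 𝓘(ℝ, E) ∞ M] (η : Π x : M, TangentSpace 𝓘(ℝ, E) x →L[ℝ] ℝ)
    (ξ : Π x : M, TangentSpace 𝓘(ℝ, E) x) : Prop where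
  smooth : SmoothField ξ
  apply_eq_one : ∀ x, η x (ξ x) = 1
  mem_ker : ∀ X : Π x : M, TangentSpace 𝓘(ℝ, E) x, SmoothField X → ∀ x, extD η ξ X x = 0

/-- The endomorphism `φ` of `V` restricts to a para-complex structure on the subspace `D`:
it preserves `D`, `φ² = Id` on `D`, and the eigenspaces of `φ|_D` for the eigenvalues `1` and `-1`
have the same dimension. -/
structure IsParaComplexOn {V : Type*} [AddCommGroup V] [Module ℝ V]
    (D : Submodule ℝ V) (φ : V →ₗ[ℝ] V) : Prop where
  mapsTo : ∀ u ∈ D, φ u ∈ D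
  sq : ∀ u ∈ D, φ (φ u) = u
  finrank_eq : Module.finrank ℝ (D ⊓ Module.End.eigenspace φ 1 : Submodule ℝ V) =
    Module.finrank ℝ (D ⊓ Module.End.eigenspace φ (-1) : Submodule ℝ V)

/-- The Nijenhuis tensor
`N_φ(X, Y) = φ²[X, Y] + [φX, φY] - φ[φX, Y] - φ[X, φY]`. -/
def nijenhuis (φ : Π x : M, TangentSpace 𝓘(ℝ, E) x →L[ℝ] TangentSpace 𝓘(ℝ, E) x)
    (X Y : Π x : M, TangentSpace 𝓘(ℝ, E) x) (x : M) : TangentSpace 𝓘(ℝ, E) x :=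
  φ x (φ x (bracket X Y x)) + bracket (fun y ↦ φ y (X y)) (fun y ↦ φ y (Y y)) x
    - φ x (bracket (fun y ↦ φ y (X y)) Y x) - φ x (bracket X (fun y ↦ φ y (Y y)) x)

variable [IsManifold 𝓘(ℝ, E) ∞ M]

/-- `(φ, ξ, η, g)` is a para-contact metric structure on the `(2n+1)`-dimensional manifold `M`. -/
structure IsParaContactMetric (n : ℕ) (φ : Π x : M, TangentSpace 𝓘(ℝ, E) x →L[ℝ] TangentSpace 𝓘(ℝ, E) x)
    (ξ : Π x : M, TangentSpace 𝓘(ℝ, E) x) (η : Π x : M, TangentSpace 𝓘(ℝ, E) x →L[ℝ] ℝ)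
    (g : SemiRiemannianMetric E M) :
    Prop where
  contact : IsContactForm n η
  reeb : IsReebField η ξ
  smooth : SmoothEndo φ
  phi_sq : ∀ (x : M) (u : TangentSpace 𝓘(ℝ, E) x), φ x (φ x u) = u - η x u • ξ x
  metric_phi : ∀ (x : M) (u v : TangentSpace 𝓘(ℝ, E) x),
    g.val x (φ x u) (φ x v) = -g.val x u v + η x u * η x v
  extD_eq : ∀ X Y : Π x : M, TangentSpace 𝓘(ℝ, E) x, SmoothField X → SmoothField Y →
    ∀ x, extD η X Y x = g.val x (X x) (φ x (Y x))
  paraComplex : ∀ x : M, IsParaComplexOn (η x).toLinearMap.ker (φ x).toLinearMap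

/-- `(φ, ξ, η, g)` is a para-Sasakian structure on the `(2n+1)`-dimensional manifold `M`:
a para-contact metric structure with `N_φ - 2 dη ⊗ ξ = 0`. -/
structure IsParaSasakian (n : ℕ) (φ : Π x : M, TangentSpace 𝓘(ℝ, E) x →L[ℝ] TangentSpace 𝓘(ℝ, E) x)
    (ξ : Π x : M, TangentSpace 𝓘(ℝ, E) x) (η : Π x : M, TangentSpace 𝓘(ℝ, E) x →L[ℝ] ℝ)
    (g : SemiRiemannianMetric E M) :
    Prop extends IsParaContactMetric n φ ξ η g where
  normal : ∀ X Y : Π x : M, TangentSpace 𝓘(ℝ, E) x, SmoothField X → SmoothField Y →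
    ∀ x, nijenhuis φ X Y x - (2 * extD η X Y x) • ξ x = 0

end Contact

end ParaSasaki

end

/-!
Write `H X = ∇_X ξ`, `A_X Y = (∇_X φ) Y` and `ω(X, Y) = g(X, φ Y) = dη(X, Y)`. The proof has
three steps.

* *`∇_X ξ = -φ X`* (`IsParaSasakian.leviCivita_xi`). Evaluating the normality condition on `ξ` gives
  `A_ξ X = H φ X - φ H X`, that is, `L_ξ φ = 0`. Inserted into the identity `d(dη) = 0`, in the form
  of the cyclic identity for `∇ ω`, this shows that `H` is skew, i.e. `ξ` is a Killing field. The
  skew part of `H` is `dη`, hence `H = -φ`.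

* *`(∇_X φ) Y = η(Y) X - g(X, Y) ξ`* (`IsParaSasakian.covDEndo_eq`). Let
  `b(X, Y, Z) = g(A_X Y - η(Y) X + g(X, Y) ξ, Z)`. The form `b` is skew in `Y, Z`, its cyclic sum
  vanishes, and `b(X, φ Y, Z) = b(X, Y, φ Z)`; the cyclic identities for `φ X, Y, Z` and for
  `φ Y, X, Z` turn the normality condition into `-2 b(Z, φ X, Y) = 0`. Hence `b = 0`, as every
  vector is a combination of `ξ` and a vector in the image of `φ`.

* *Curvature.* The first two steps give `R(X, Y) ξ = η(X) Y - η(Y) X` (`IsParaSasakian.curv_xi`).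
  Differentiating this along `V` with `∇ R = 0` and `∇_V ξ = -φ V` yields
  `R(X, Y) φ V = g(X, φ V) Y - g(Y, φ V) X` (`IsParaSasakian.curv_phi`). Both formulas are instances
  of `R(X, Y) Z = g(X, Z) Y - g(Y, Z) X`, which therefore holds for `Z = φ² Z + η(Z) ξ`: the
  curvature tensor is that of a space of constant curvature `-1`.

The geometric input is that the connection preserves smoothness (`SmoothField.covD`), so that the
curvature is additive and homogeneous in its last argument, and that derivations along vector
fields commute up to the bracket (`lieD_bracket`), which gives `d(dη) = 0`.
-/

namespace ParaSasaki

/-! ### Smooth vector fields -/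

section SmoothCalculus

theorem natCast_le_infty (n : ℕ) : (n : WithTop ℕ∞) ≤ ∞ := by
  exact_mod_cast (le_top : (n : ℕ∞) ≤ ⊤)

variable {E : Type*} [NormedAddCommGroup E] [NormedSpace ℝ E]
  {M : Type*} [TopologicalSpace M] [ChartedSpace E M] [IsManifold 𝓘(ℝ, E) ∞ M]

theorem SmoothField.mdiffAt {X : Π x : M, TangentSpace 𝓘(ℝ, E) x} (hX : SmoothField X) (x : M) :
    MDiffAt (T% X) x :=
  hX.mdifferentiable (by simp) x

theorem SmoothField.neg {X : Π x : M, TangentSpace 𝓘(ℝ, E) x} (hX : SmoothField X) :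
    SmoothField (-X) :=
  ContMDiff.neg_section hX

theorem SmoothField.smul {f : M → ℝ} {X : Π x : M, TangentSpace 𝓘(ℝ, E) x}
    (hf : ContMDiff 𝓘(ℝ, E) 𝓘(ℝ) ∞ f) (hX : SmoothField X) : SmoothField (f • X) :=
  ContMDiff.smul_section hf hX

theorem SmoothField.endo {φ : Π x : M, TangentSpace 𝓘(ℝ, E) x →L[ℝ] TangentSpace 𝓘(ℝ, E) x}
    {X : Π x : M, TangentSpace 𝓘(ℝ, E) x} (hφ : SmoothEndo φ) (hX : SmoothField X) :
    SmoothField (fun x ↦ φ x (X x)) :=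
  ContMDiff.clm_bundle_apply (F₁ := E) (F₂ := E) hφ hX

theorem contMDiffAt_metric (g : SemiRiemannianMetric E M) {X Y : Π x : M, TangentSpace 𝓘(ℝ, E) x}
    {x : M} (hX : CMDiffAt ∞ (T% X) x) (hY : CMDiffAt ∞ (T% Y) x) :
    ContMDiffAt 𝓘(ℝ, E) 𝓘(ℝ) ∞ (fun x ↦ g.val x (X x) (Y x)) x := by
  have : ContMDiffAt 𝓘(ℝ, E) (𝓘(ℝ, E).prod 𝓘(ℝ)) ∞
      (fun m ↦ TotalSpace.mk' ℝ (E := Bundle.Trivial M ℝ) m (g.val m (X m) (Y m))) x := by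
    apply ContMDiffAt.clm_bundle_apply₂ (F₁ := E) (F₂ := E)
    · exact g.contMDiff x
    · exact hX
    · exact hY
  simp only [contMDiffAt_totalSpace] at this
  exact this.2

theorem contMDiff_metric (g : SemiRiemannianMetric E M) {X Y : Π x : M, TangentSpace 𝓘(ℝ, E) x}
    (hX : SmoothField X) (hY : SmoothField Y) :
    ContMDiff 𝓘(ℝ, E) 𝓘(ℝ) ∞ (fun x ↦ g.val x (X x) (Y x)) :=
  fun x ↦ contMDiffAt_metric g (hX x) (hY x)

theorem contMDiff_lieD {X : Π x : M, TangentSpace 𝓘(ℝ, E) x} {f : M → ℝ}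
    (hX : SmoothField X) (hf : ContMDiff 𝓘(ℝ, E) 𝓘(ℝ) ∞ f) :
    ContMDiff 𝓘(ℝ, E) 𝓘(ℝ) ∞ (lieD X f) := by
  have h : ContMDiff 𝓘(ℝ, E) 𝓘(ℝ).tangent ∞
      (fun x ↦ tangentMap 𝓘(ℝ, E) 𝓘(ℝ) f (TotalSpace.mk' E x (X x))) :=
    (hf.contMDiff_tangentMap (m := ∞) (by simp)).comp hX
  intro x
  have := ((contMDiffAt_totalSpace).1 (h x)).2
  simpa [tangentMap, lieD, mvfderiv] using! this

theorem SmoothField.bracket [FiniteDimensional ℝ E] {X Y : Π x : M, TangentSpace 𝓘(ℝ, E) x}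
    (hX : SmoothField X) (hY : SmoothField Y) : SmoothField (bracket X Y) := by
  have : CompleteSpace E := FiniteDimensional.complete ℝ E
  have : IsManifold 𝓘(ℝ, E) (((⊤ : ℕ∞) : WithTop ℕ∞) + 1) M := by simpa
  have : IsManifold 𝓘(ℝ, E) (minSmoothness ℝ 2) M :=
    IsManifold.of_le (n := ∞) (by simpa using! natCast_le_infty 2)
  exact ContDiff.mlieBracket_vectorField (n := ⊤) (m := ⊤) hX hY (by simp)

/-- Every tangent vector is the value of a globally defined smooth vector field. -/
theorem exists_smoothField [FiniteDimensional ℝ E] [T2Space M] {x : M}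
    (v : TangentSpace 𝓘(ℝ, E) x) :
    ∃ X : Π x : M, TangentSpace 𝓘(ℝ, E) x, SmoothField X ∧ X x = v := by
  let e := trivializationAt E (TangentSpace 𝓘(ℝ, E)) x
  obtain ⟨ψ⟩ : Nonempty (SmoothBumpFunction 𝓘(ℝ, E) x) := inferInstance
  refine ⟨(ψ : M → ℝ) • FiberBundle.extend E v, ?_, ?_⟩
  · have hs : CMDiff[e.baseSet] ∞ (T% (FiberBundle.extend E v)) := by
      rw [e.contMDiffOn_section_baseSet_iff]
      refine (contMDiffOn_const (c := (e ⟨x, v⟩).2)).congr fun y hy ↦ ?_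
      have h := congr_arg Prod.snd (e.apply_mk_symm hy (e ⟨x, v⟩).2)
      exact h
    exact ContMDiffOn.smul_section_of_tsupport ψ.contMDiff.contMDiffOn e.open_baseSet
      (by simpa [e] using ψ.tsupport_subset_chartAt_source) hs
  · simp

/-- Two tangent vectors with the same inner products against all smooth fields are equal. -/
theorem ext_of_metric_smooth [FiniteDimensional ℝ E] [T2Space M] (g : SemiRiemannianMetric E M)
    {x : M} {u v : TangentSpace 𝓘(ℝ, E) x}
    (h : ∀ Z : Π x : M, TangentSpace 𝓘(ℝ, E) x, SmoothField Z →
      g.val x u (Z x) = g.val x v (Z x)) : u = v := by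
  rw [← sub_eq_zero]
  refine g.nondegenerate x _ fun w ↦ ?_
  obtain ⟨Z, hZ, rfl⟩ := exists_smoothField w
  simp [h Z hZ]

theorem bracket_leibniz [FiniteDimensional ℝ E] {X Y Z : Π x : M, TangentSpace 𝓘(ℝ, E) x}
    (hX : SmoothField X) (hY : SmoothField Y) (hZ : SmoothField Z) (x : M) :
    bracket X (bracket Y Z) x = bracket (bracket X Y) Z x + bracket Y (bracket X Z) x := by
  have : CompleteSpace E := FiniteDimensional.complete ℝ E
  have : IsManifold 𝓘(ℝ, E) (minSmoothness ℝ 3) M :=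
    IsManifold.of_le (n := ∞) (by simpa using! natCast_le_infty 3)
  have two_le : minSmoothness ℝ 2 ≤ ∞ := by simpa using! natCast_le_infty 2
  exact leibniz_identity_mlieBracket_apply
    ((hX x).of_le two_le) ((hY x).of_le two_le) ((hZ x).of_le two_le)

theorem bracket_jacobi [FiniteDimensional ℝ E] {X Y Z : Π x : M, TangentSpace 𝓘(ℝ, E) x}
    (hX : SmoothField X) (hY : SmoothField Y) (hZ : SmoothField Z) (x : M) :
    bracket (bracket X Y) Z x + bracket (bracket Y Z) X x + bracket (bracket Z X) Y x = 0 := by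
  have : CompleteSpace E := FiniteDimensional.complete ℝ E
  have : IsManifold 𝓘(ℝ, E) (minSmoothness ℝ 2) M :=
    IsManifold.of_le (n := ∞) (by simpa using! natCast_le_infty 2)
  have h1 : bracket (bracket Z X) Y x = bracket Y (bracket X Z) x := by
    have e : bracket X Z = (-1 : ℝ) • bracket Z X := by
      rw [neg_one_smul]; exact mlieBracket_swap
    have e' := mlieBracket_const_smul_right (I := 𝓘(ℝ, E)) (V := Y) (c := (-1 : ℝ))
      ((hZ.bracket hX).mdiffAt x)
    rw [e]
    refine Eq.trans ?_ e'.symm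
    rw [neg_one_smul]
    exact mlieBracket_swap_apply
  have h2 : bracket (bracket Y Z) X x = - bracket X (bracket Y Z) x :=
    mlieBracket_swap_apply
  rw [h1, h2, bracket_leibniz hX hY hZ]
  abel

/-- The commutator of derivations is the derivation along the bracket. This follows from the
Jacobi identity for `X`, `Y` and `f • Z`, where `Z` does not vanish at the point considered; no
chart is needed. -/
theorem lieD_bracket [FiniteDimensional ℝ E] [T2Space M] {X Y : Π x : M, TangentSpace 𝓘(ℝ, E) x}
    {f : M → ℝ} (hX : SmoothField X) (hY : SmoothField Y)
    (hf : ContMDiff 𝓘(ℝ, E) 𝓘(ℝ) ∞ f) (x : M) :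
    lieD (bracket X Y) f x = lieD X (lieD Y f) x - lieD Y (lieD X f) x := by
  rcases subsingleton_or_nontrivial E with hE | hE
  · have h0 (Z : Π x : M, TangentSpace 𝓘(ℝ, E) x) (y : M) : Z y = 0 :=
      Subsingleton.elim (α := E) _ _
    simp [lieD, h0]
  obtain ⟨v, hv⟩ := exists_ne (0 : E)
  obtain ⟨Z, hZ, hZx⟩ := exists_smoothField (x := x) v
  have hm {f : M → ℝ} (hf : ContMDiff 𝓘(ℝ, E) 𝓘(ℝ) ∞ f) (y : M) : MDiffAt f y :=
    hf.mdifferentiable (by simp) y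
  have leib {f : M → ℝ} (hf : ContMDiff 𝓘(ℝ, E) 𝓘(ℝ) ∞ f) (W : Π x : M, TangentSpace 𝓘(ℝ, E) x)
      {W' : Π x : M, TangentSpace 𝓘(ℝ, E) x} (hW' : SmoothField W') :
      bracket W (f • W') = lieD W f • W' + f • bracket W W' := by
    ext y
    rw [bracket, mlieBracket_smul_right (hm hf y) (hW'.mdiffAt y)]
    rfl
  have radd (V : Π x : M, TangentSpace 𝓘(ℝ, E) x) {W W' : Π x : M, TangentSpace 𝓘(ℝ, E) x}
      (hW : SmoothField W) (hW' : SmoothField W') :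
      bracket V (W + W') x = bracket V W x + bracket V W' x :=
    mlieBracket_add_right (hW.mdiffAt x) (hW'.mdiffAt x)
  have hXf := contMDiff_lieD hX hf
  have hYf := contMDiff_lieD hY hf
  have h1 := bracket_leibniz hX hY (hZ.smul hf) x
  have h2 := bracket_leibniz hX hY hZ x
  rw [leib hf _ hZ, leib hf _ hZ, leib hf _ hZ,
    radd _ (hZ.smul hYf) ((hY.bracket hZ).smul hf),
    radd _ (hZ.smul hXf) ((hX.bracket hZ).smul hf),
    leib hYf _ hZ, leib hXf _ hZ, leib hf _ (hY.bracket hZ), leib hf _ (hX.bracket hZ)] at h1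
  simp only [Pi.add_apply, Pi.smul_apply', h2] at h1
  have h3 : (lieD (bracket X Y) f x - (lieD X (lieD Y f) x - lieD Y (lieD X f) x)) • Z x = 0 := by
    linear_combination (norm := module) -h1
  rw [smul_eq_zero, sub_eq_zero] at h3
  exact h3.resolve_right (hZx ▸ hv)

/-- A vector field is smooth as soon as its inner products with all smooth fields are: its
coefficients in a local frame are obtained from such inner products by a matrix that is smooth and
invertible near the given point. -/
theorem SmoothField.of_metric [FiniteDimensional ℝ E] [T2Space M] (g : SemiRiemannianMetric E M)
    {W : Π x : M, TangentSpace 𝓘(ℝ, E) x}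
    (h : ∀ Z : Π x : M, TangentSpace 𝓘(ℝ, E) x, SmoothField Z →
      ContMDiff 𝓘(ℝ, E) 𝓘(ℝ) ∞ (fun x ↦ g.val x (W x) (Z x))) : SmoothField W := by
  intro x₀
  let e := trivializationAt E (TangentSpace 𝓘(ℝ, E)) x₀
  let b := Module.finBasis ℝ E
  let ι := Fin (Module.finrank ℝ E)
  have hx₀ : x₀ ∈ e.baseSet := FiberBundle.mem_baseSet_trivializationAt' x₀
  have hframe := e.isLocalFrameOn_localFrame_baseSet 𝓘(ℝ, E) ∞ b
  -- global smooth fields that agree with the frame at `x₀`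
  choose Z hZ hZx using fun i ↦ exists_smoothField (e.localFrame b i x₀)
  -- the elementary matrix with entry `1` in row `i` and column `j`
  let L (i j : ι) : (ι → ℝ) →L[ℝ] (ι → ℝ) :=
    (ContinuousLinearMap.proj (R := ℝ) (φ := fun _ : ι ↦ ℝ) j).smulRight (Pi.single i (1 : ℝ))
  -- the matrix of inner products of the fields `Z i` with the local frame
  let T (x : M) : (ι → ℝ) →L[ℝ] (ι → ℝ) :=
    ∑ i, ∑ j, g.val x (e.localFrame b j x) (Z i x) • L i j
  have hTapply (x : M) (w : ι → ℝ) (i : ι) :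
      T x w i = g.val x (∑ j, w j • e.localFrame b j x) (Z i x) := by
    simp [T, L, Pi.single_apply, mul_comm]
    rfl
  have hT : ContMDiffAt 𝓘(ℝ, E) 𝓘(ℝ, (ι → ℝ) →L[ℝ] (ι → ℝ)) ∞ T x₀ := by
    refine ContMDiffAt.sum fun i _ ↦ ContMDiffAt.sum fun j _ ↦ ?_
    exact (contMDiffAt_metric g (contMDiffAt_localFrame_of_mem _ e b j hx₀)
      (hZ i x₀)).smul contMDiffAt_const
  have hinj : Function.Injective (T x₀) := by
    rw [injective_iff_map_eq_zero]
    intro w hw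
    have h0 : ∑ j, w j • e.localFrame b j x₀ = 0 := by
      refine g.nondegenerate x₀ _ fun v ↦ ?_
      have hv := hframe.coeff_sum_eq (FiberBundle.extend E v) hx₀
      rw [FiberBundle.extend_apply_self] at hv
      rw [hv, map_sum]
      refine Finset.sum_eq_zero fun i _ ↦ ?_
      rw [map_smul, ← hZx, ← hTapply, hw]
      simp
    have := (Fintype.linearIndependent_iff.1 (hframe.linearIndependent hx₀)) w h0
    exact funext this
  have hinv : (T x₀).IsInvertible :=
    ⟨(LinearEquiv.ofInjectiveEndo (T x₀).toLinearMap hinj).toContinuousLinearEquiv, by ext; rfl⟩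
  have hnhds : ∀ᶠ S in nhds (T x₀), S.IsInvertible := by
    obtain ⟨S, hS⟩ := hinv
    exact hS ▸ S.nhds
  have hd : ContMDiffAt 𝓘(ℝ, E) 𝓘(ℝ, ι → ℝ) ∞ (fun x i ↦ g.val x (W x) (Z i x)) x₀ :=
    contMDiffAt_pi_space.2 fun i ↦ h _ (hZ i) x₀
  have hc : ContMDiffAt 𝓘(ℝ, E) 𝓘(ℝ, ι → ℝ) ∞
      (fun x ↦ (T x).inverse (fun i ↦ g.val x (W x) (Z i x))) x₀ :=
    (hinv.contDiffAt_map_inverse.comp_contMDiffAt hT).clm_apply hd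
  have hW : (fun x i ↦ hframe.coeff i x (W x)) =ᶠ[nhds x₀]
      fun x ↦ (T x).inverse (fun i ↦ g.val x (W x) (Z i x)) := by
    filter_upwards [e.open_baseSet.mem_nhds hx₀,
      hT.continuousAt.eventually hnhds] with x hx hxT
    refine ((ContinuousLinearMap.IsInvertible.inverse_apply_eq hxT).2 ?_).symm
    ext i
    rw [hTapply]
    exact congr(g.val x $(hframe.coeff_sum_eq W hx) (Z i x))
  refine hframe.contMDiffAt_of_coeff_aux (fun i ↦ ?_) e.open_baseSet hx₀
  exact contMDiffAt_pi_space.1 (hc.congr_of_eventuallyEq hW) i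

variable [FiniteDimensional ℝ E]

/-- The Levi-Civita connection maps smooth fields to smooth fields, by Koszul's formula. -/
theorem SmoothField.covD [T2Space M] (g : SemiRiemannianMetric E M)
    {X Y : Π x : M, TangentSpace 𝓘(ℝ, E) x}
    (hX : SmoothField X) (hY : SmoothField Y) : SmoothField (covD g X Y) := by
  refine SmoothField.of_metric g fun Z hZ ↦ ?_
  have h : (fun x ↦ g.val x (ParaSasaki.covD g X Y x) (Z x)) =
      fun x ↦ (1 / 2 : ℝ) * koszul g X Y Z x := by
    ext x
    rw [← nabla_koszul g (hX.mdiffAt x) (hY.mdiffAt x) (hZ.mdiffAt x)]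
    simp [ParaSasaki.covD, leviCivita]
  rw [h]
  refine contMDiff_const.mul ?_
  unfold koszul
  exact (((((contMDiff_lieD hX (contMDiff_metric g hY hZ)).add
    (contMDiff_lieD hY (contMDiff_metric g hX hZ))).sub
    (contMDiff_lieD hZ (contMDiff_metric g hX hY))).add
    (contMDiff_metric g (hX.bracket hY) hZ)).sub
    (contMDiff_metric g (hX.bracket hZ) hY)).sub
    (contMDiff_metric g (hY.bracket hZ) hX)

end SmoothCalculus

/-! ### The Levi-Civita connection -/

section Derivations

variable {E : Type*} [NormedAddCommGroup E] [NormedSpace ℝ E]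
  {M : Type*} [TopologicalSpace M] [ChartedSpace E M] {X : Π x : M, TangentSpace 𝓘(ℝ, E) x}

theorem lieD_add {f h : M → ℝ} (hf : ContMDiff 𝓘(ℝ, E) 𝓘(ℝ) ∞ f)
    (hh : ContMDiff 𝓘(ℝ, E) 𝓘(ℝ) ∞ h) (x : M) :
    lieD X (fun y ↦ f y + h y) x = lieD X f x + lieD X h x :=
  congr($(mvfderiv_add (hf.mdifferentiable (by simp) x) (hh.mdifferentiable (by simp) x)) (X x))

theorem lieD_sub {f h : M → ℝ} (hf : ContMDiff 𝓘(ℝ, E) 𝓘(ℝ) ∞ f)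
    (hh : ContMDiff 𝓘(ℝ, E) 𝓘(ℝ) ∞ h) (x : M) :
    lieD X (fun y ↦ f y - h y) x = lieD X f x - lieD X h x :=
  congr($(mvfderiv_sub (hf.mdifferentiable (by simp) x) (hh.mdifferentiable (by simp) x)) (X x))

theorem lieD_const (c : ℝ) (x : M) : lieD X (fun _ ↦ c) x = 0 := by
  simp [lieD, mvfderiv_const]

theorem lieD_neg {f : M → ℝ} (x : M) : lieD X (fun y ↦ - f y) x = - lieD X f x := by
  change mvfderiv 𝓘(ℝ, E) (-f) x (X x) = _
  rw [mvfderiv_neg]; rfl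

end Derivations

section Connection

variable {E : Type*} [NormedAddCommGroup E] [NormedSpace ℝ E] [FiniteDimensional ℝ E]
  {M : Type*} [TopologicalSpace M] [ChartedSpace E M] [IsManifold 𝓘(ℝ, E) ∞ M]
  (g : SemiRiemannianMetric E M) {X Y Z : Π x : M, TangentSpace 𝓘(ℝ, E) x}

theorem koszul_covD (hX : SmoothField X) (hY : SmoothField Y) (hZ : SmoothField Z) (x : M) :
    2 * g.val x (covD g X Y x) (Z x) = koszul g X Y Z x :=
  nabla_koszul g (hX.mdiffAt x) (hY.mdiffAt x) (hZ.mdiffAt x)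

theorem covD_add (hY : SmoothField Y) (hZ : SmoothField Z) (x : M) :
    covD g X (Y + Z) x = covD g X Y x + covD g X Z x :=
  congr($((leviCivita g).isCovariantDerivativeOnUniv.add (hY.mdiffAt x) (hZ.mdiffAt x)) (X x))

theorem covD_smul {f : M → ℝ} (hf : ContMDiff 𝓘(ℝ, E) 𝓘(ℝ) ∞ f) (hY : SmoothField Y) (x : M) :
    covD g X (f • Y) x = f x • covD g X Y x + lieD X f x • Y x := by
  have := congr($((leviCivita g).isCovariantDerivativeOnUniv.leibniz (hY.mdiffAt x)
    (hf.mdifferentiable (by simp) x)) (X x))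
  simpa [covD, lieD] using! this

theorem covD_neg (hY : SmoothField Y) (x : M) : covD g X (-Y) x = - covD g X Y x := by
  have h := covD_smul g (X := X) (contMDiff_const (c := (-1 : ℝ))) hY x
  rw [lieD_const] at h
  have e : (fun _ : M ↦ (-1 : ℝ)) • Y = -Y := by ext y; simp
  simpa [e] using h

theorem covD_sub (hY : SmoothField Y) (hZ : SmoothField Z) (x : M) :
    covD g X (Y - Z) x = covD g X Y x - covD g X Z x := by
  rw [sub_eq_add_neg, covD_add g hY hZ.neg, covD_neg g hZ, sub_eq_add_neg]

/-- The Levi-Civita connection is metric. -/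
theorem lieD_metric (hX : SmoothField X) (hY : SmoothField Y) (hZ : SmoothField Z) (x : M) :
    lieD X (fun y ↦ g.val y (Y y) (Z y)) x =
      g.val x (covD g X Y x) (Z x) + g.val x (Y x) (covD g X Z x) := by
  have h1 := koszul_covD g hX hY hZ x
  have h2 := koszul_covD g hX hZ hY x
  have e : (fun y ↦ g.val y (Z y) (Y y)) = fun y ↦ g.val y (Y y) (Z y) := by
    ext y; exact g.symm _ _ _
  have e2 : bracket Z Y x = - bracket Y Z x := mlieBracket_swap_apply
  simp only [koszul, e, e2, map_neg, _root_.neg_apply] at h1 h2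
  rw [g.symm x (Y x)]
  linarith

variable [T2Space M]

/-- The Levi-Civita connection is torsion-free. -/
theorem bracket_eq (hX : SmoothField X) (hY : SmoothField Y) (x : M) :
    bracket X Y x = covD g X Y x - covD g Y X x := by
  refine ext_of_metric_smooth g fun Z hZ ↦ ?_
  have h1 := koszul_covD g hX hY hZ x
  have h2 := koszul_covD g hY hX hZ x
  have e : (fun y ↦ g.val y (Y y) (X y)) = fun y ↦ g.val y (X y) (Y y) := by
    ext y; exact g.symm _ _ _
  have e2 : bracket Y X x = - bracket X Y x := mlieBracket_swap_apply
  simp only [koszul, e, e2, map_neg, _root_.neg_apply, map_sub, _root_.sub_apply] at h1 h2 ⊢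
  linarith

theorem curv_add {W : Π x : M, TangentSpace 𝓘(ℝ, E) x} (hX : SmoothField X) (hY : SmoothField Y)
    (hZ : SmoothField Z) (hW : SmoothField W) (x : M) :
    curv g X Y (Z + W) x = curv g X Y Z x + curv g X Y W x := by
  have h {V : Π x : M, TangentSpace 𝓘(ℝ, E) x} :
      covD g V (Z + W) = covD g V Z + covD g V W := by ext y; exact covD_add g hZ hW y
  simp only [curv, h, Pi.add_apply, covD_add g (hY.covD g hZ) (hY.covD g hW),
    covD_add g (hX.covD g hZ) (hX.covD g hW)]
  abel

/-- The derivatives of `f` cancel, by `lieD_bracket`. -/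
theorem curv_smul {f : M → ℝ} (hf : ContMDiff 𝓘(ℝ, E) 𝓘(ℝ) ∞ f) (hX : SmoothField X)
    (hY : SmoothField Y) (hZ : SmoothField Z) (x : M) :
    curv g X Y (f • Z) x = f x • curv g X Y Z x := by
  have h {V : Π x : M, TangentSpace 𝓘(ℝ, E) x} :
      covD g V (f • Z) = f • covD g V Z + lieD V f • Z := by ext y; exact covD_smul g hf hZ y
  have hXf := contMDiff_lieD hX hf
  have hYf := contMDiff_lieD hY hf
  have hXZ := hX.covD g hZ
  have hYZ := hY.covD g hZ
  simp only [curv, h, Pi.add_apply, Pi.smul_apply', covD_add g (hYZ.smul hf) (hZ.smul hYf),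
    covD_add g (hXZ.smul hf) (hZ.smul hXf), covD_smul g hf hYZ, covD_smul g hf hXZ,
    covD_smul g hXf hZ, covD_smul g hYf hZ, lieD_bracket hX hY hf]
  module

end Connection

/-! ### Para-contact metric structures -/

section ParaContact

variable {E : Type*} [NormedAddCommGroup E] [NormedSpace ℝ E]
  {M : Type*} [TopologicalSpace M] [ChartedSpace E M] [IsManifold 𝓘(ℝ, E) ∞ M]
  {n : ℕ} {φ : Π x : M, TangentSpace 𝓘(ℝ, E) x →L[ℝ] TangentSpace 𝓘(ℝ, E) x}
  {ξ : Π x : M, TangentSpace 𝓘(ℝ, E) x} {η : Π x : M, TangentSpace 𝓘(ℝ, E) x →L[ℝ] ℝ}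
  {g : SemiRiemannianMetric E M} {X Y Z : Π x : M, TangentSpace 𝓘(ℝ, E) x}

namespace IsParaContactMetric

theorem phi_xi (h : IsParaContactMetric n φ ξ η g) (x : M) : φ x (ξ x) = 0 := by
  have h0 : φ x (φ x (ξ x)) = 0 := by simp [h.phi_sq, h.reeb.apply_eq_one]
  have h1 : φ x (ξ x) = η x (φ x (ξ x)) • ξ x := by
    have := h.phi_sq x (φ x (ξ x))
    rw [h0, map_zero, eq_comm, sub_eq_zero] at this
    exact this
  have h2 : η x (φ x (ξ x)) • φ x (ξ x) = 0 := by rw [← map_smul, ← h1, h0]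
  rcases smul_eq_zero.1 h2 with h3 | h3
  · rw [h1, h3, zero_smul]
  · exact h3

theorem eta_phi (h : IsParaContactMetric n φ ξ η g) (x : M) (u : TangentSpace 𝓘(ℝ, E) x) :
    η x (φ x u) = 0 := by
  have h1 := h.phi_sq x (φ x u)
  rw [h.phi_sq x u, map_sub, map_smul, h.phi_xi, smul_zero, sub_zero, eq_comm, sub_eq_self] at h1
  have h2 := congr_arg (η x) h1
  simpa [h.reeb.apply_eq_one] using h2

/-- `η` is the `1`-form dual to `ξ`, so `η(X)` is a particular inner product. -/
theorem metric_xi (h : IsParaContactMetric n φ ξ η g) (x : M) (u : TangentSpace 𝓘(ℝ, E) x) :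
    g.val x u (ξ x) = η x u := by
  have := h.metric_phi x u (ξ x)
  simp only [h.phi_xi, map_zero, h.reeb.apply_eq_one] at this
  linarith

theorem metric_phi_left (h : IsParaContactMetric n φ ξ η g) (x : M)
    (u v : TangentSpace 𝓘(ℝ, E) x) : g.val x (φ x u) v = - g.val x u (φ x v) := by
  have h1 := h.metric_phi x (φ x u) v
  rw [h.phi_sq, h.eta_phi, map_sub, map_smul, _root_.sub_apply, _root_.smul_apply, g.symm x (ξ x),
    h.metric_xi, h.eta_phi] at h1
  simp only [smul_eq_mul, mul_zero, zero_mul, sub_zero, add_zero] at h1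
  linarith

theorem contMDiff_eta (h : IsParaContactMetric n φ ξ η g) (hX : SmoothField X) :
    ContMDiff 𝓘(ℝ, E) 𝓘(ℝ) ∞ (fun x ↦ η x (X x)) := by
  simpa only [h.metric_xi] using contMDiff_metric g hX h.reeb.smooth

theorem smoothField_phi (h : IsParaContactMetric n φ ξ η g) (hX : SmoothField X) :
    SmoothField (fun x ↦ φ x (X x)) :=
  SmoothField.endo h.smooth hX

end IsParaContactMetric

variable [FiniteDimensional ℝ E]

/-- The covariant derivative `(∇_X φ) Y = ∇_X (φ Y) - φ (∇_X Y)` of a `(1,1)`-tensor field. -/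
noncomputable def covDEndo (g : SemiRiemannianMetric E M)
    (φ : Π x : M, TangentSpace 𝓘(ℝ, E) x →L[ℝ] TangentSpace 𝓘(ℝ, E) x)
    (X Y : Π x : M, TangentSpace 𝓘(ℝ, E) x) (x : M) : TangentSpace 𝓘(ℝ, E) x :=
  covD g X (fun y ↦ φ y (Y y)) x - φ x (covD g X Y x)

namespace IsParaContactMetric

/-- `∇_X (φ ξ) = 0`. -/
theorem covDEndo_xi (h : IsParaContactMetric n φ ξ η g) (x : M) :
    covDEndo g φ X ξ x = - φ x (covD g X ξ x) := by
  have e : (fun y ↦ φ y (ξ y)) = 0 := by ext y; exact h.phi_xi y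
  simp [covDEndo, e, covD]

/-- `g(ξ, ξ) = 1` is constant, so `∇_X ξ` is orthogonal to `ξ`. -/
theorem eta_covD_xi (h : IsParaContactMetric n φ ξ η g) (hX : SmoothField X) (x : M) :
    η x (covD g X ξ x) = 0 := by
  have h1 := lieD_metric g hX h.reeb.smooth h.reeb.smooth x
  simp only [h.metric_xi, h.reeb.apply_eq_one, lieD_const] at h1
  rw [g.symm x (ξ x), h.metric_xi] at h1
  linarith

theorem lieD_eta (h : IsParaContactMetric n φ ξ η g) (hX : SmoothField X) (hY : SmoothField Y)
    (x : M) : lieD X (fun y ↦ η y (Y y)) x = η x (covD g X Y x) + g.val x (Y x) (covD g X ξ x) := by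
  have h1 := lieD_metric g hX hY h.reeb.smooth x
  simpa only [h.metric_xi] using h1

/-- `∇_X φ` is skew, because `φ` is. -/
theorem covDEndo_skew (h : IsParaContactMetric n φ ξ η g) (hX : SmoothField X)
    (hY : SmoothField Y) (hZ : SmoothField Z) (x : M) :
    g.val x (covDEndo g φ X Y x) (Z x) = - g.val x (Y x) (covDEndo g φ X Z x) := by
  have h1 := lieD_metric g hX (h.smoothField_phi hY) hZ x
  have h2 := lieD_metric g hX hY (h.smoothField_phi hZ) x
  simp only [h.metric_phi_left, lieD_neg] at h1
  simp only [covDEndo, map_sub, _root_.sub_apply, h.metric_phi_left]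
  linarith

/-- The derivative of `φ² = Id - η ⊗ ξ`. -/
theorem covDEndo_phi (h : IsParaContactMetric n φ ξ η g) (hX : SmoothField X)
    (hY : SmoothField Y) (x : M) :
    covDEndo g φ X (fun y ↦ φ y (Y y)) x + φ x (covDEndo g φ X Y x) =
      -(g.val x (Y x) (covD g X ξ x) • ξ x) - η x (Y x) • covD g X ξ x := by
  have e : (fun y ↦ φ y (φ y (Y y))) = Y - (fun y ↦ η y (Y y)) • ξ := by
    ext y; exact h.phi_sq y _
  have hη := h.contMDiff_eta hY
  simp only [covDEndo]
  rw [e, map_sub, covD_sub g hY (h.reeb.smooth.smul hη), covD_smul g hη h.reeb.smooth, h.phi_sq,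
    h.lieD_eta hX hY]
  module

variable [T2Space M]

/-- The skew part of `∇ ξ` is `dη`. -/
theorem covD_xi_skew_part (h : IsParaContactMetric n φ ξ η g) (hX : SmoothField X)
    (hY : SmoothField Y) (x : M) :
    g.val x (covD g X ξ x) (Y x) - g.val x (covD g Y ξ x) (X x) =
      2 * g.val x (X x) (φ x (Y x)) := by
  have h1 := h.extD_eq X Y hX hY x
  simp only [extD, h.lieD_eta hX hY, h.lieD_eta hY hX, bracket_eq g hX hY, map_sub] at h1
  rw [g.symm x (covD g X ξ x), g.symm x (covD g Y ξ x)]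
  linarith

/-- `d(dη) = 0`, expressed through `∇ φ`. -/
theorem covDEndo_cyclic (h : IsParaContactMetric n φ ξ η g) (hX : SmoothField X)
    (hY : SmoothField Y) (hZ : SmoothField Z) (x : M) :
    g.val x (Y x) (covDEndo g φ X Z x) + g.val x (Z x) (covDEndo g φ Y X x) +
      g.val x (X x) (covDEndo g φ Z Y x) = 0 := by
  -- `2 X(dη(Y, Z)) - 2 dη([X, Y], Z)`, computed with the connection and from the definition of `dη`
  have key {X Y Z : Π x : M, TangentSpace 𝓘(ℝ, E) x} (hX : SmoothField X) (hY : SmoothField Y)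
      (hZ : SmoothField Z) : 2 * g.val x (Y x) (covDEndo g φ X Z x) +
        2 * g.val x (covD g Y X x) (φ x (Z x)) + 2 * g.val x (Y x) (φ x (covD g X Z x)) =
      lieD X (lieD Y fun y ↦ η y (Z y)) x - lieD X (lieD Z fun y ↦ η y (Y y)) x
      - lieD X (fun y ↦ η y (bracket Y Z y)) x - lieD (bracket X Y) (fun y ↦ η y (Z y)) x
      + lieD Z (fun y ↦ η y (bracket X Y y)) x + η x (bracket (bracket X Y) Z x) := by
    -- the function `2 dη(Y, Z)`, its factor written as a sum so that `lieD_add` applies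
    have hd : (fun y ↦ g.val y (Y y) (φ y (Z y)) + g.val y (Y y) (φ y (Z y))) = fun y ↦
        lieD Y (fun y ↦ η y (Z y)) y - lieD Z (fun y ↦ η y (Y y)) y - η y (bracket Y Z y) := by
      ext y
      rw [← h.extD_eq Y Z hY hZ, extD]
      ring
    have hω := contMDiff_metric g hY (h.smoothField_phi hZ)
    have hYZ := contMDiff_lieD hY (h.contMDiff_eta hZ)
    have hZY := contMDiff_lieD hZ (h.contMDiff_eta hY)
    have h1 := congr_arg (fun f ↦ lieD X f x) hd
    simp only [lieD_add hω hω, lieD_sub (hYZ.sub hZY) (h.contMDiff_eta (hY.bracket hZ)),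
      lieD_sub hYZ hZY, lieD_metric g hX hY (h.smoothField_phi hZ)] at h1
    have h2 := h.extD_eq _ Z (hX.bracket hY) hZ x
    rw [extD, bracket_eq g hX hY, map_sub, _root_.sub_apply] at h2
    simp only [covDEndo, map_sub]
    linarith
  have k1 := key hX hY hZ
  have k2 := key hY hZ hX
  have k3 := key hZ hX hY
  have s (u v : TangentSpace 𝓘(ℝ, E) x) : g.val x u (φ x v) = - g.val x v (φ x u) := by
    rw [g.symm x u, h.metric_phi_left]
  have j := congr_arg (η x) (bracket_jacobi hX hY hZ x)
  simp only [map_add, map_zero] at j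
  rw [lieD_bracket hX hY (h.contMDiff_eta hZ)] at k1
  rw [lieD_bracket hY hZ (h.contMDiff_eta hX)] at k2
  rw [lieD_bracket hZ hX (h.contMDiff_eta hY)] at k3
  have s1 := s (covD g Y X x) (Z x)
  have s2 := s (covD g Z Y x) (X x)
  have s3 := s (covD g X Z x) (Y x)
  linarith

end IsParaContactMetric

/-- The normality condition, expressed through `∇ φ`. -/
theorem IsParaSasakian.covDEndo_normal [T2Space M] (h : IsParaSasakian n φ ξ η g)
    (hX : SmoothField X) (hY : SmoothField Y) (x : M) :
    covDEndo g φ (fun y ↦ φ y (X y)) Y x - covDEndo g φ (fun y ↦ φ y (Y y)) X x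
      - φ x (covDEndo g φ X Y x) + φ x (covDEndo g φ Y X x) =
      (2 * g.val x (X x) (φ x (Y x))) • ξ x := by
  have hφX := h.smoothField_phi hX
  have hφY := h.smoothField_phi hY
  have h1 := h.normal X Y hX hY x
  rw [h.extD_eq X Y hX hY, sub_eq_zero] at h1
  rw [← h1]
  simp only [nijenhuis, bracket_eq g hX hY, bracket_eq g hφX hφY, bracket_eq g hφX hY,
    bracket_eq g hX hφY, covDEndo, map_sub]
  abel

end ParaContact

/-! ### Para-Sasakian structures -/

section ParaSasakian

variable {E : Type*} [NormedAddCommGroup E] [NormedSpace ℝ E] [FiniteDimensional ℝ E]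
  {M : Type*} [TopologicalSpace M] [T2Space M] [ChartedSpace E M] [IsManifold 𝓘(ℝ, E) ∞ M]
  {n : ℕ} {φ : Π x : M, TangentSpace 𝓘(ℝ, E) x →L[ℝ] TangentSpace 𝓘(ℝ, E) x}
  {ξ : Π x : M, TangentSpace 𝓘(ℝ, E) x} {η : Π x : M, TangentSpace 𝓘(ℝ, E) x →L[ℝ] ℝ}
  {g : SemiRiemannianMetric E M} {V X Y Z : Π x : M, TangentSpace 𝓘(ℝ, E) x}

namespace IsParaSasakian

/-- `∇_u ξ = -φ u`. Normality gives `L_ξ φ = 0`, and then `d(dη) = 0` makes `∇ ξ` skew, so that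
it equals its skew part `dη`. -/
theorem leviCivita_xi (h : IsParaSasakian n φ ξ η g) (x : M) (u : TangentSpace 𝓘(ℝ, E) x) :
    leviCivita g ξ x u = - φ x u := by
  let H := leviCivita g ξ x
  have hξ := h.reeb.smooth
  have hηH (u) : η x (H u) = 0 := by
    obtain ⟨X, hX, rfl⟩ := exists_smoothField u
    exact h.eta_covD_xi hX x
  have hsk (u v) : g.val x (H u) v - g.val x (H v) u = 2 * g.val x u (φ x v) := by
    obtain ⟨X, hX, rfl⟩ := exists_smoothField u
    obtain ⟨Y, hY, rfl⟩ := exists_smoothField v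
    exact h.covD_xi_skew_part hX hY x
  -- the integral curves of `ξ` are geodesics
  have hHξ : H (ξ x) = 0 := by
    refine g.nondegenerate x _ fun v ↦ ?_
    have h1 := hsk (ξ x) v
    rw [g.symm x (ξ x), h.metric_xi, h.metric_xi, hηH, h.eta_phi] at h1
    linarith
  -- an equivalent form of `L_ξ φ = 0`
  have hA {X : Π x : M, TangentSpace 𝓘(ℝ, E) x} (hX : SmoothField X) :
      covDEndo g φ ξ X x = H (φ x (X x)) - φ x (H (X x)) := by
    have h0 : covDEndo g φ (fun y ↦ φ y (ξ y)) X x = 0 := by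
      simp [covDEndo, covD, h.phi_xi]
    have h1 := h.covDEndo_normal hX hξ x
    rw [h0, h.covDEndo_xi, h.covDEndo_xi, h.phi_xi, map_zero, mul_zero, zero_smul] at h1
    have h2 := congr_arg (φ x) h1
    have h3 : η x (covDEndo g φ ξ X x) = 0 := by
      rw [← h.metric_xi, h.covDEndo_skew hξ hX hξ, h.covDEndo_xi]
      change -g.val x (X x) (-φ x (H (ξ x))) = 0
      simp [hHξ]
    change φ x (-φ x (H (φ x (X x))) - 0 - φ x (-φ x (H (X x)))
      + φ x (covDEndo g φ ξ X x)) = _ at h2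
    simp only [map_add, map_sub, map_neg, map_zero, h.phi_sq, h3, hηH, zero_smul, sub_zero] at h2
    linear_combination (norm := module) h2
  -- `d(dη) = 0` evaluated on `ξ` makes `H` skew on the image of `φ`
  have hskφ (u v) : g.val x v (H (φ x u)) = - g.val x (φ x u) (H v) := by
    obtain ⟨X, hX, rfl⟩ := exists_smoothField u
    obtain ⟨Y, hY, rfl⟩ := exists_smoothField v
    have h1 := h.covDEndo_cyclic hξ hY hX x
    rw [hA hX, h.covDEndo_xi, g.symm x (ξ x), h.covDEndo_skew hX hY hξ, h.covDEndo_xi] at h1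
    change g.val x (Y x) (H (φ x (X x)) - φ x (H (X x))) + g.val x (X x) (-φ x (H (Y x))) +
      -g.val x (Y x) (-φ x (H (X x))) = 0 at h1
    rw [h.metric_phi_left]
    simp only [map_sub, map_neg] at h1
    linarith
  have hskew (u v) : g.val x v (H u) = - g.val x u (H v) := by
    have h1 := hskφ (φ x u) v
    simpa [h.phi_sq, hHξ, g.symm x (ξ x), h.metric_xi, hηH] using h1
  rw [← sub_eq_zero]
  refine g.nondegenerate x _ fun v ↦ ?_
  have h1 := hsk u v
  have h2 := hskew u v
  have h3 := h.metric_phi_left x u v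
  rw [g.symm x v] at h2
  rw [g.symm x (H v)] at h1
  change g.val x (H u - -φ x u) v = 0
  simp only [map_sub, map_neg, _root_.sub_apply, _root_.neg_apply]
  linarith

theorem covD_xi (h : IsParaSasakian n φ ξ η g) (X : Π x : M, TangentSpace 𝓘(ℝ, E) x) :
    covD g X ξ = - fun x ↦ φ x (X x) := by
  ext x
  exact h.leviCivita_xi x (X x)

/-- The covariant derivative of the structure tensor, `(∇_X φ) Y = η(Y) X - g(X, Y) ξ`. -/
theorem covDEndo_eq (h : IsParaSasakian n φ ξ η g) (hX : SmoothField X) (hY : SmoothField Y)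
    (x : M) : covDEndo g φ X Y x = η x (Y x) • X x - g.val x (X x) (Y x) • ξ x := by
  -- the difference of the two sides, as a trilinear form; the aim is `b = 0`
  let b (X Y Z : Π x : M, TangentSpace 𝓘(ℝ, E) x) : ℝ :=
    g.val x (covDEndo g φ X Y x + g.val x (X x) (Y x) • ξ x - η x (Y x) • X x) (Z x)
  have hξ := h.reeb.smooth
  have hφ {X : Π x : M, TangentSpace 𝓘(ℝ, E) x} (hX : SmoothField X) := h.smoothField_phi hX
  have b_eq (X Y Z : Π x : M, TangentSpace 𝓘(ℝ, E) x) : b X Y Z =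
      g.val x (covDEndo g φ X Y x) (Z x) + g.val x (X x) (Y x) * η x (Z x)
        - η x (Y x) * g.val x (X x) (Z x) := by
    simp only [b, map_add, map_sub, map_smul, _root_.add_apply, _root_.sub_apply,
      _root_.smul_apply, g.symm x (ξ x), h.metric_xi, smul_eq_mul]
  have b_skew {X Y Z : Π x : M, TangentSpace 𝓘(ℝ, E) x} (hX : SmoothField X) (hY : SmoothField Y)
      (hZ : SmoothField Z) : b X Y Z = - b X Z Y := by
    have h1 := h.covDEndo_skew hX hY hZ x
    rw [g.symm x (Y x)] at h1
    rw [b_eq, b_eq]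
    linarith
  have b_phi {X Y Z : Π x : M, TangentSpace 𝓘(ℝ, E) x} (hX : SmoothField X) (hY : SmoothField Y) :
      b X (fun y ↦ φ y (Y y)) Z = b X Y (fun y ↦ φ y (Z y)) := by
    have h1 := congr_arg (fun v ↦ g.val x v (Z x)) (h.covDEndo_phi hX hY x)
    simp only [h.covD_xi, Pi.neg_apply, map_add, map_sub, map_neg, map_smul, _root_.add_apply,
      _root_.sub_apply, _root_.neg_apply, _root_.smul_apply, h.metric_phi_left, smul_eq_mul,
      smul_neg, g.symm x (ξ x), h.metric_xi, neg_smul] at h1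
    rw [g.symm x (Y x), h.metric_phi_left] at h1
    simp only [b_eq, h.eta_phi]
    linarith
  have b_cyc {X Y Z : Π x : M, TangentSpace 𝓘(ℝ, E) x} (hX : SmoothField X) (hY : SmoothField Y)
      (hZ : SmoothField Z) : b X Y Z + b Y Z X + b Z X Y = 0 := by
    have h1 := h.covDEndo_cyclic hX hZ hY x
    rw [g.symm x (Z x), g.symm x (Y x), g.symm x (X x)] at h1
    rw [b_eq, b_eq, b_eq, g.symm x (Y x) (X x), g.symm x (Z x) (X x), g.symm x (Z x) (Y x)]
    linarith
  have b_normal {X Y Z : Π x : M, TangentSpace 𝓘(ℝ, E) x} (hX : SmoothField X)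
      (hY : SmoothField Y) : b (fun y ↦ φ y (X y)) Y Z - b (fun y ↦ φ y (Y y)) X Z
        + b X Y (fun y ↦ φ y (Z y)) - b Y X (fun y ↦ φ y (Z y)) = 0 := by
    have h1 := congr_arg (fun v ↦ g.val x v (Z x)) (h.covDEndo_normal hX hY x)
    simp only [map_add, map_sub, map_smul, _root_.add_apply, _root_.sub_apply, _root_.smul_apply,
      h.metric_phi_left, smul_eq_mul, g.symm x (ξ x), h.metric_xi] at h1
    simp only [b_eq, h.eta_phi, h.metric_phi_left]
    rw [g.symm x (Y x) (φ x (X x)), h.metric_phi_left, g.symm x (Y x) (X x)]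
    linarith
  have b_zero {X Y Z : Π x : M, TangentSpace 𝓘(ℝ, E) x} (hX : SmoothField X) (hY : SmoothField Y)
      (hZ : SmoothField Z) : b Z (fun y ↦ φ y (X y)) Y = 0 := by
    -- the two cyclic identities turn `b_normal` into `-2 b(Z, φ X, Y) = 0`
    have c1 := b_cyc (hφ hX) hY hZ
    have c2 := b_cyc (hφ hY) hX hZ
    have p1 := b_phi (Z := Z) hY hX
    have p2 := b_phi (Z := Z) hX hY
    have p3 := b_phi (Z := X) hZ hY
    have s1 := b_skew hY hZ (hφ hX)
    have s2 := b_skew hX hZ (hφ hY)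
    have s3 := b_skew hZ (hφ hX) hY
    have nn := b_normal (Z := Z) hX hY
    linarith
  have hBξ : b X ξ Y = 0 := by
    have h1 := h.covDEndo_xi (X := X) x
    rw [h.covD_xi, Pi.neg_apply, map_neg, neg_neg, h.phi_sq] at h1
    rw [b_eq, h1, h.reeb.apply_eq_one, h.metric_xi]
    simp only [map_sub, map_smul, _root_.sub_apply, _root_.smul_apply, smul_eq_mul,
      g.symm x (ξ x), h.metric_xi]
    ring
  rw [← sub_eq_zero]
  refine g.nondegenerate x _ fun w ↦ ?_
  -- it suffices to test against `φ² W` and against `ξ`, as `W = φ² W + η(W) ξ`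
  obtain ⟨W, hW, rfl⟩ := exists_smoothField w
  have h1 : b X Y (fun y ↦ φ y (φ y (W y))) = 0 := by
    rw [← b_phi (Z := fun y ↦ φ y (W y)) hX hY, b_zero hY (hφ hW) hX]
  have h2 : b X Y ξ = 0 := by rw [b_skew hX hY hξ, hBξ, neg_zero]
  have h3 : b X Y W = 0 := by
    simp only [b_eq] at h1 h2 ⊢
    simp only [h.phi_sq, map_sub, map_smul, smul_eq_mul] at h1
    linear_combination h1 + η x (W x) * h2
  rw [← h3]
  change _ = g.val x _ _
  congr 2
  abel

theorem curv_xi (h : IsParaSasakian n φ ξ η g) (hX : SmoothField X) (hY : SmoothField Y) (x : M) :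
    curv g X Y ξ x = η x (X x) • Y x - η x (Y x) • X x := by
  have h1 := h.covDEndo_eq hX hY x
  have h2 := h.covDEndo_eq hY hX x
  rw [g.symm x (Y x)] at h2
  simp only [covDEndo] at h1 h2
  simp only [curv, h.covD_xi, covD_neg g (h.smoothField_phi hX), covD_neg g (h.smoothField_phi hY),
    Pi.neg_apply, bracket_eq g hX hY, map_sub]
  linear_combination (norm := module) h2 - h1

/-- On the image of `φ` the curvature is that of constant curvature `-1`: this is the covariant
derivative along `V` of the formula `R(X, Y) ξ = η(X) Y - η(Y) X`. -/
theorem curv_phi (h : IsParaSasakian n φ ξ η g) (hsymm : IsLocallySymmetric g)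
    (hV : SmoothField V) (hX : SmoothField X) (hY : SmoothField Y) (x : M) :
    curv g X Y (fun y ↦ φ y (V y)) x =
      g.val x (X x) (φ x (V x)) • Y x - g.val x (Y x) (φ x (V x)) • X x := by
  have hξ := h.reeb.smooth
  have hηX := h.contMDiff_eta hX
  have hηY := h.contMDiff_eta hY
  have hR : curv g X Y ξ = (fun y ↦ η y (X y)) • Y - (fun y ↦ η y (Y y)) • X := by
    ext y; exact h.curv_xi hX hY y
  have hneg : curv g X Y (- fun y ↦ φ y (V y)) x = - curv g X Y (fun y ↦ φ y (V y)) x := by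
    have e : (- fun y ↦ φ y (V y)) = (fun _ : M ↦ (-1 : ℝ)) • fun y ↦ φ y (V y) := by
      ext y; simp
    rw [e, curv_smul g contMDiff_const hX hY (h.smoothField_phi hV), neg_one_smul]
  have h1 := hsymm V X Y ξ hV hX hY hξ x
  rw [covDCurv, hR, h.curv_xi (hV.covD g hX) hY, h.curv_xi hX (hV.covD g hY), h.covD_xi, hneg,
    covD_sub g (hY.smul hηX) (hX.smul hηY), covD_smul g hηX hY, covD_smul g hηY hX,
    h.lieD_eta hV hX, h.lieD_eta hV hY, h.covD_xi] at h1
  simp only [Pi.neg_apply, map_neg] at h1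
  linear_combination (norm := module) h1

end IsParaSasakian

end ParaSasakian

end ParaSasaki

/-! ### Locally symmetric para-Sasakian manifolds -/

theorem mainTheorem8 {E : Type*} [NormedAddCommGroup E] [NormedSpace ℝ E] [FiniteDimensional ℝ E]
    {M : Type*} [TopologicalSpace M] [T2Space M] [SecondCountableTopology M]
    [ChartedSpace E M] [IsManifold 𝓘(ℝ, E) ∞ M]
    (n : ℕ) (φ : Π x : M, TangentSpace 𝓘(ℝ, E) x →L[ℝ] TangentSpace 𝓘(ℝ, E) x)
    (ξ : Π x : M, TangentSpace 𝓘(ℝ, E) x) (η : Π x : M, TangentSpace 𝓘(ℝ, E) x →L[ℝ] ℝ)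
    (g : ParaSasaki.SemiRiemannianMetric E M)
    (hM : ParaSasaki.IsParaSasakian n φ ξ η g)
    (hsymm : ParaSasaki.IsLocallySymmetric g) :
    ParaSasaki.HasConstantSectionalCurvature g (-1) := by
  intro X Y hX hY x hgram
  have hηY := hM.contMDiff_eta hY
  have hφφ := hM.smoothField_phi (hM.smoothField_phi hY)
  -- `curv_phi` and `curv_xi` apply to the two summands
  have hdecomp : Y = (fun y ↦ φ y (φ y (Y y))) + (fun y ↦ η y (Y y)) • ξ := by
    ext y
    simp [hM.phi_sq]
  have hR : ParaSasaki.curv g X Y Y x =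
      g.val x (X x) (Y x) • Y x - g.val x (Y x) (Y x) • X x := by
    have h1 : ParaSasaki.curv g X Y Y x = ParaSasaki.curv g X Y
      ((fun y ↦ φ y (φ y (Y y))) + (fun y ↦ η y (Y y)) • ξ) x := by rw [← hdecomp]
    rw [h1, ParaSasaki.curv_add g hX hY hφφ (hM.reeb.smooth.smul hηY),
      ParaSasaki.curv_smul g hηY hX hY hM.reeb.smooth, hM.curv_xi hX hY,
      hM.curv_phi hsymm (hM.smoothField_phi hY) hX hY]
    simp only [hM.phi_sq, map_sub, map_smul, hM.metric_xi, smul_eq_mul]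
    module
  rw [ParaSasaki.sectionalCurvature, hR, div_eq_iff hgram]
  simp only [ParaSasaki.gram, map_sub, map_smul, _root_.sub_apply, _root_.smul_apply, smul_eq_mul,
    g.symm x (Y x) (X x)]
  ring
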